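/- Let $\Pi=(\pi_{ij})_{i,j\in\{0,1\}}$ be a stochastic matrix with all $\pi_{ij}>0$ and $\det\Pi>0$, and let $0<\varepsilon<1$. Let $(Y_t)_{t\in\mathbb Z}$ be a stationary Markov chain on $\{0,1\}$ with transition matrix $\Pi$, let $(E_t)_{t\in\mathbb Z}$ be i.i.d. with $P(E_t=1)=\varepsilon$, $P(E_t=0)=1-\varepsilon$, independent of $Y$, and let $Z_t=Y_t\oplus E_t$ (addition modulo $2$). Put $p_E(0)=1-\varepsilon$, $p_E(1)=\varepsilon$ and, for $z\in\{0,1\}$ and $x> 0$, $$f_z(x)=\frac{p_E(z)}{p_E(1-z)}\cdot\frac{\pi_{00}x+\pi_{10}}{\pi_{01}x+\pi_{11}},$$ $$r_z(x)=\frac{(p_E(z)\pi_{00}+p_E(1-z)\pi_{01})x+(p_E(z)\pi_{10}+p_E(1-z)\pi_{11})}{x+1},$$ $$r(x)=-\bigl(r_0(x)\log r_0(x)+r_1(x)\log r_1(x)\bigr),$$ with natural logarithms. Each $f_z$ has a unique positive fixed point $p_z$; let $I$ be the closed interval with endpoints $p_1$ and $p_0$. For a word $i_1\dots i_n$ over $\{0,1\}$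 let $I_{i_1\dots i_n}=f_{i_n}\circ\cdots\circ f_{i_1}(I)$ and $p_{i_1\dots i_n}=P(Z_1=i_1,\dots,Z_n=i_n)$ (for the empty word these are $I$ and $1$). Assume the non-overlapping case: $f_0(I)\cup f_1(I)\subsetneq I$. Then $r$ attains on every $I_{i_1\dots i_n}$ a minimum $r^m_{i_1\dots i_n}$ and a maximum $r^M_{i_1\dots i_n}$, the entropy rate $H(Z)=\lim_{n\to\infty}\frac1n H(Z_1,\dots,Z_n)$ (Shannon entropy with natural logarithm) exists, and for every $n\ge 0$ $$\sum_{i_1\dots i_n} r^m_{i_1\dots i_n}\,p_{i_1\dots i_n}\;\le\; H(Z)\;\le\;\sum_{i_1\dots i_n} r^M_{i_1\dots i_n}\,p_{i_1\dots i_n}.$$ -/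

import Mathlib

open MeasureTheory ProbabilityTheory Filter Topology

namespace NoisyChain

/-! ### The processes -/

/-- `Y` is a (two-sided) stationary Markov chain with state space `{0, 1}` and
transition matrix `P` under the probability measure `μ`. -/
structure IsStationaryMarkovChain {Ω : Type*} [MeasurableSpace Ω] (μ : Measure Ω)
    (Y : ℤ → Ω → Fin 2) (P : Matrix (Fin 2) (Fin 2) ℝ) : Prop where
  measurable : ∀ t, Measurable (Y t)
  /-- the law of the whole process is invariant under time shifts -/
  stationary : ∀ s : ℤ,
    IdentDistrib (fun (ω : Ω) (t : ℤ) => Y (t + s) ω) (fun (ω : Ω) (t : ℤ) => Y t ω) μ μ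
  /-- conditionally on `Y_s = y_0, …, Y_{s+n} = y_n`, the next state `Y_{s+n+1}` equals `y_{n+1}`
  with probability `P y_n y_{n+1}` -/
  markov : ∀ (s : ℤ) (n : ℕ) (y : ℕ → Fin 2),
    μ.real {ω | ∀ k : ℕ, k ≤ n + 1 → Y (s + k) ω = y k} =
      μ.real {ω | ∀ k : ℕ, k ≤ n → Y (s + k) ω = y k} * P (y n) (y (n + 1))

/-- `E` is an i.i.d. sequence of Bernoulli variables with `ℙ(E_t = 1) = ε`. -/
structure IsBernoulliNoise {Ω : Type*} [MeasurableSpace Ω] (μ : Measure Ω)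
    (E : ℤ → Ω → Fin 2) (ε : ℝ) : Prop where
  measurable : ∀ t, Measurable (E t)
  indep : iIndepFun E μ
  prob_one : ∀ t, μ.real {ω | E t ω = 1} = ε

/-- The output of the binary symmetric channel: `Z_t = Y_t ⊕ E_t`
(addition in `Fin 2` is addition modulo two). -/
def output {Ω : Type*} (Y E : ℤ → Ω → Fin 2) : ℤ → Ω → Fin 2 :=
  fun t ω => Y t ω + E t ω

/-- `p_{i_1 … i_n} = ℙ(Z_1 = i_1, …, Z_n = i_n)`. The letter `i_{k+1}` is `w k`. -/
noncomputable def wordProb {Ω : Type*} [MeasurableSpace Ω] (μ : Measure Ω)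
    (Z : ℤ → Ω → Fin 2) {n : ℕ} (w : Fin n → Fin 2) : ℝ :=
  μ.real {ω | ∀ k : Fin n, Z ((k : ℕ) + 1) ω = w k}

/-- The Shannon entropy `H(Z_1, …, Z_n)` (natural logarithm, `0 log 0 = 0`). -/
noncomputable def blockEntropy {Ω : Type*} [MeasurableSpace Ω] (μ : Measure Ω)
    (Z : ℤ → Ω → Fin 2) (n : ℕ) : ℝ :=
  -∑ w : Fin n → Fin 2, wordProb μ Z w * Real.log (wordProb μ Z w)

/-- `h` is the entropy rate of `Z`: `H(Z_1, …, Z_n) / n → h`. -/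
def IsEntropyRate {Ω : Type*} [MeasurableSpace Ω] (μ : Measure Ω)
    (Z : ℤ → Ω → Fin 2) (h : ℝ) : Prop :=
  Tendsto (fun n : ℕ => blockEntropy μ Z n / n) atTop (𝓝 h)

/-! ### The dynamical system on the half line -/

/-- The noise distribution: `p_E(0) = 1 - ε`, `p_E(1) = ε`. -/
def noiseProb (ε : ℝ) (z : Fin 2) : ℝ := if z = 0 then 1 - ε else ε

/-- `f_z(x) = (p_E(z) / p_E(1 - z)) * (π₀₀ x + π₁₀) / (π₀₁ x + π₁₁)`. -/
noncomputable def f (P : Matrix (Fin 2) (Fin 2) ℝ) (ε : ℝ) (z : Fin 2) (x : ℝ) : ℝ :=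
  noiseProb ε z / noiseProb ε (1 - z) * ((P 0 0 * x + P 1 0) / (P 0 1 * x + P 1 1))

/-- `r_z(x)`, the conditional probability that the next output is `z`. -/
noncomputable def rProb (P : Matrix (Fin 2) (Fin 2) ℝ) (ε : ℝ) (z : Fin 2) (x : ℝ) : ℝ :=
  ((noiseProb ε z * P 0 0 + noiseProb ε (1 - z) * P 0 1) * x +
    (noiseProb ε z * P 1 0 + noiseProb ε (1 - z) * P 1 1)) / (x + 1)

/-- `r(x) = -(r_0(x) log r_0(x) + r_1(x) log r_1(x))`. -/
noncomputable def r (P : Matrix (Fin 2) (Fin 2) ℝ) (ε : ℝ) (x : ℝ) : ℝ :=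
  -(rProb P ε 0 x * Real.log (rProb P ε 0 x) + rProb P ε 1 x * Real.log (rProb P ε 1 x))

/-- Each `f_z` has exactly one positive fixed point. -/
theorem existsUnique_pos_fixedPoint (P : Matrix (Fin 2) (Fin 2) ℝ) (ε : ℝ)
    (hP : ∀ i j, 0 < P i j) (hε₀ : 0 < ε) (hε₁ : ε < 1) (z : Fin 2) :
    ∃! x : ℝ, 0 < x ∧ f P ε z x = x := by
  have hn : ∀ z, 0 < noiseProb ε z := by
    intro z
    unfold noiseProb
    split_ifs <;> linarith
  have hc : 0 < noiseProb ε z / noiseProb ε (1 - z) := div_pos (hn _) (hn _)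
  have hA := hP 0 0
  have hB := hP 1 0
  have hC := hP 0 1
  have hD := hP 1 1
  unfold f
  generalize noiseProb ε z / noiseProb ε (1 - z) = c at hc
  generalize P 0 0 = A at *
  generalize P 1 0 = B at *
  generalize P 0 1 = C at *
  generalize P 1 1 = D at *
  have key : ∀ x : ℝ, 0 < x →
      (c * ((A * x + B) / (C * x + D)) = x ↔ C * x * x + (D - c * A) * x - c * B = 0) := by
    intro x hx
    have h : 0 < C * x + D := by positivity
    rw [← mul_div_assoc, div_eq_iff h.ne']
    constructor <;> intro h <;> linarith
  have hcB : 0 < c * B := by positivity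
  obtain ⟨s, hs0, hs⟩ : ∃ s : ℝ, 0 ≤ s ∧ s * s = (D - c * A) ^ 2 + 4 * C * (c * B) :=
    ⟨√((D - c * A) ^ 2 + 4 * C * (c * B)), Real.sqrt_nonneg _,
      Real.mul_self_sqrt (by positivity)⟩
  have hCB : 0 < C * (c * B) := by positivity
  have hpos : 0 < -(D - c * A) + s := by
    by_contra hcon
    push Not at hcon
    nlinarith
  refine ⟨(-(D - c * A) + s) / (2 * C), ⟨by positivity, ?_⟩, ?_⟩
  · rw [key _ (by positivity)]
    field_simp
    nlinarith
  · rintro y ⟨hy, hfy⟩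
    rw [key _ hy] at hfy
    have h1 : (2 * C * y + (D - c * A) - s) * (2 * C * y + (D - c * A) + s) = 0 := by
      nlinarith
    rw [eq_div_iff (by positivity)]
    rcases mul_eq_zero.1 h1 with h | h
    · linarith
    · exfalso
      have : C * y + (D - c * A) > 0 := by
        by_contra hcon
        push Not at hcon
        nlinarith
      nlinarith [mul_pos hC hy]

/-- `p_z`, the positive fixed point of `f_z`. -/
noncomputable def fixedPoint (P : Matrix (Fin 2) (Fin 2) ℝ) (ε : ℝ) (z : Fin 2) : ℝ :=
  Classical.epsilon fun x : ℝ => 0 < x ∧ f P ε z x = x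

/-- The closed interval `I` with endpoints `p_1` and `p_0`; it is `[p_1, p_0]` when
`p_1 ≤ p_0`, that is, when `ε ≤ 1 / 2`. -/
noncomputable def interval (P : Matrix (Fin 2) (Fin 2) ℝ) (ε : ℝ) : Set ℝ :=
  Set.uIcc (fixedPoint P ε 1) (fixedPoint P ε 0)

/-- The non-overlapping case: `f_0(I) ∪ f_1(I)` is a proper subset of `I`. -/
def NonOverlapping (P : Matrix (Fin 2) (Fin 2) ℝ) (ε : ℝ) : Prop :=
  f P ε 0 '' interval P ε ∪ f P ε 1 '' interval P ε ⊂ interval P ε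

/-- `I_{i_1 … i_n} = (f_{i_n} ∘ ⋯ ∘ f_{i_1})(I)`. -/
noncomputable def cylinder (P : Matrix (Fin 2) (Fin 2) ℝ) (ε : ℝ) {n : ℕ}
    (w : Fin n → Fin 2) : Set ℝ :=
  (fun x : ℝ => (List.ofFn w).foldl (fun t i => f P ε i t) x) '' interval P ε

/-- `r^m_{i_1 … i_n}`, the minimum of `r` over `I_{i_1 … i_n}`. -/
noncomputable def rMin (P : Matrix (Fin 2) (Fin 2) ℝ) (ε : ℝ) {n : ℕ}
    (w : Fin n → Fin 2) : ℝ :=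
  sInf (r P ε '' cylinder P ε w)

/-- `r^M_{i_1 … i_n}`, the maximum of `r` over `I_{i_1 … i_n}`. -/
noncomputable def rMax (P : Matrix (Fin 2) (Fin 2) ℝ) (ε : ℝ) {n : ℕ}
    (w : Fin n → Fin 2) : ℝ :=
  sSup (r P ε '' cylinder P ε w)

end NoisyChain

namespace NoisyChain

/-! ### Forward recursion for the hidden Markov filter. -/

section Algebra

variable {P : Matrix (Fin 2) (Fin 2) ℝ} {ε : ℝ}

/-! The joint weights of an output word and the final hidden state obey a linear recursion (`step`).
The ratio of the two weights forgets normalisation and moves by `f_z` when the letter `z` is read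
(`weight_div`). Given a word with filter ratio `x`, the next letter is `z` with probability
`r_z(x)`, so by the chain rule the increment of the block entropy is the average of `r` at the
filter ratio (`listEntropy_succ_sub`).

The filter starts at the stationary ratio `π₁₀ / π₀₁`, which lies in `I` (`statRatio_mem_interval`),
and `I` is invariant under both maps. After a word `u ++ w` the ratio therefore lies in `I_w`,
whatever the past `u` was. Bounding `r` by its extrema on `I_w` and summing over `u`, which
stationarity allows, encloses every increment from index `n` on between the two sums
(`listEntropy_increment_bounds`). Averaging increments passes the bounds to the limit of the
entropies divided by length, which exists by subadditivity. `wordProb_eq_listProb` identifies the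
recursion with the law of the process. -/

theorem noiseProb_pos (hε₀ : 0 < ε) (hε₁ : ε < 1) (z : Fin 2) : 0 < noiseProb ε z := by
  unfold noiseProb
  split_ifs <;> linarith

/-- One step of the forward recursion for the unnormalised filter. -/
noncomputable def step (P : Matrix (Fin 2) (Fin 2) ℝ) (ε : ℝ) (a : Fin 2 → ℝ) (z : Fin 2) :
    Fin 2 → ℝ :=
  fun j => noiseProb ε (z + j) * ∑ i, a i * P i j

/-- The stationary distribution of the transition matrix. -/
noncomputable def statDist (P : Matrix (Fin 2) (Fin 2) ℝ) : Fin 2 → ℝ :=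
  ![P 1 0 / (P 0 1 + P 1 0), P 0 1 / (P 0 1 + P 1 0)]

/-- The joint weight of an output word and the final hidden state. -/
noncomputable def weight (P : Matrix (Fin 2) (Fin 2) ℝ) (ε : ℝ) (l : List (Fin 2)) :
    Fin 2 → ℝ :=
  l.foldl (step P ε) (statDist P)

/-- The probability of an output word, computed by the forward recursion. -/
noncomputable def listProb (P : Matrix (Fin 2) (Fin 2) ℝ) (ε : ℝ) (l : List (Fin 2)) : ℝ :=
  ∑ j, weight P ε l j

/-- The filter ratio after a word, started from the ratio `x`. -/
noncomputable def filterRatio (P : Matrix (Fin 2) (Fin 2) ℝ) (ε : ℝ) (x : ℝ)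
    (l : List (Fin 2)) : ℝ :=
  l.foldl (fun t i => f P ε i t) x

theorem step_pos (hpos : ∀ i j, 0 < P i j) (hε₀ : 0 < ε) (hε₁ : ε < 1) {a : Fin 2 → ℝ}
    (ha : ∀ j, 0 < a j) (z j : Fin 2) : 0 < step P ε a z j := by
  refine mul_pos (noiseProb_pos hε₀ hε₁ _) ?_
  exact Finset.sum_pos (fun i _ => mul_pos (ha i) (hpos i j)) Finset.univ_nonempty

theorem statDist_pos (hpos : ∀ i j, 0 < P i j) (j : Fin 2) : 0 < statDist P j := by
  have h0 := hpos 0 1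
  have h1 := hpos 1 0
  fin_cases j <;> simp [statDist] <;> positivity

theorem weight_append_singleton (l : List (Fin 2)) (z : Fin 2) :
    weight P ε (l ++ [z]) = step P ε (weight P ε l) z := by
  simp [weight]

theorem weight_pos (hpos : ∀ i j, 0 < P i j) (hε₀ : 0 < ε) (hε₁ : ε < 1) (l : List (Fin 2))
    (j : Fin 2) : 0 < weight P ε l j := by
  induction l using List.reverseRecOn generalizing j with
  | nil => exact statDist_pos hpos j
  | append_singleton l z ih =>
    rw [weight_append_singleton]
    exact step_pos hpos hε₀ hε₁ ih z j

theorem listProb_pos (hpos : ∀ i j, 0 < P i j) (hε₀ : 0 < ε) (hε₁ : ε < 1)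
    (l : List (Fin 2)) : 0 < listProb P ε l :=
  Finset.sum_pos (fun j _ => weight_pos hpos hε₀ hε₁ l j) Finset.univ_nonempty

theorem listProb_nil (hpos : ∀ i j, 0 < P i j) : listProb P ε [] = 1 := by
  have h0 := hpos 0 1
  have h1 := hpos 1 0
  simp [listProb, weight, statDist]
  field_simp
  ring

theorem add_one_eq_one_sub (z : Fin 2) : z + 1 = 1 - z := by
  fin_cases z <;> rfl

theorem f_weight_div (hpos : ∀ i j, 0 < P i j) (hε₀ : 0 < ε) (hε₁ : ε < 1) {a : Fin 2 → ℝ}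
    (ha : ∀ j, 0 < a j) (z : Fin 2) :
    step P ε a z 0 / step P ε a z 1 = f P ε z (a 0 / a 1) := by
  have hz := noiseProb_pos hε₀ hε₁ (1 - z)
  have h0 := ha 0
  have h1 := ha 1
  have h01 := hpos 0 1
  have h11 := hpos 1 1
  simp only [step, f, Fin.sum_univ_two, add_zero, add_one_eq_one_sub]
  field_simp

theorem weight_div (hpos : ∀ i j, 0 < P i j) (hε₀ : 0 < ε) (hε₁ : ε < 1)
    (l : List (Fin 2)) :
    weight P ε l 0 / weight P ε l 1 = filterRatio P ε (P 1 0 / P 0 1) l := by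
  induction l using List.reverseRecOn with
  | nil =>
    have h0 := hpos 0 1
    have h1 := hpos 1 0
    simp [weight, statDist, filterRatio]
    field_simp
  | append_singleton l z ih =>
    rw [weight_append_singleton, f_weight_div hpos hε₀ hε₁ (weight_pos hpos hε₀ hε₁ l), ih]
    simp [filterRatio]

theorem filterRatio_pos (hpos : ∀ i j, 0 < P i j) (hε₀ : 0 < ε) (hε₁ : ε < 1)
    (l : List (Fin 2)) : 0 < filterRatio P ε (P 1 0 / P 0 1) l := by
  rw [← weight_div hpos hε₀ hε₁]
  exact div_pos (weight_pos hpos hε₀ hε₁ l 0) (weight_pos hpos hε₀ hε₁ l 1)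

theorem listProb_append_singleton (hpos : ∀ i j, 0 < P i j) (hε₀ : 0 < ε) (hε₁ : ε < 1)
    (l : List (Fin 2)) (z : Fin 2) :
    listProb P ε (l ++ [z]) =
      listProb P ε l * rProb P ε z (filterRatio P ε (P 1 0 / P 0 1) l) := by
  have h0 := weight_pos hpos hε₀ hε₁ l 0
  have h1 := weight_pos hpos hε₀ hε₁ l 1
  rw [← weight_div hpos hε₀ hε₁]
  simp only [listProb, weight_append_singleton, step, rProb, Fin.sum_univ_two, add_zero,
    add_one_eq_one_sub]
  field_simp
  ring

theorem rProb_pos (hpos : ∀ i j, 0 < P i j) (hε₀ : 0 < ε) (hε₁ : ε < 1) {x : ℝ} (hx : 0 < x)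
    (z : Fin 2) : 0 < rProb P ε z x := by
  have h0 := noiseProb_pos hε₀ hε₁ z
  have h1 := noiseProb_pos hε₀ hε₁ (1 - z)
  have h00 := hpos 0 0
  have h01 := hpos 0 1
  have h10 := hpos 1 0
  have h11 := hpos 1 1
  unfold rProb
  positivity

theorem rProb_add (hrow : ∀ i, P i 0 + P i 1 = 1) {x : ℝ} (hx : 0 < x) :
    rProb P ε 0 x + rProb P ε 1 x = 1 := by
  have h0 := hrow 0
  have h1 := hrow 1
  have hx1 : x + 1 ≠ 0 := by positivity
  unfold rProb
  rw [← add_div, div_eq_one_iff_eq hx1]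
  simp only [noiseProb]
  simp
  linear_combination x * h0 + h1

theorem sum_listProb_append_singleton (hrow : ∀ i, P i 0 + P i 1 = 1)
    (hpos : ∀ i j, 0 < P i j) (hε₀ : 0 < ε) (hε₁ : ε < 1) (l : List (Fin 2)) :
    ∑ z, listProb P ε (l ++ [z]) = listProb P ε l := by
  simp_rw [listProb_append_singleton hpos hε₀ hε₁, ← Finset.mul_sum]
  rw [Fin.sum_univ_two, rProb_add hrow (filterRatio_pos hpos hε₀ hε₁ l), mul_one]

theorem step_statDist_sum (hrow : ∀ i, P i 0 + P i 1 = 1) (hpos : ∀ i j, 0 < P i j) :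
    step P ε (statDist P) 0 + step P ε (statDist P) 1 = statDist P := by
  have h0 := hrow 0
  have h1 := hrow 1
  have h01 := hpos 0 1
  have h10 := hpos 1 0
  have e0 : P 0 0 = 1 - P 0 1 := by linarith
  have e1 : P 1 1 = 1 - P 1 0 := by linarith
  funext j
  fin_cases j <;> simp [step, statDist, noiseProb, Fin.sum_univ_two, e0, e1] <;> field_simp <;>
    ring

theorem step_add (a b : Fin 2 → ℝ) (z : Fin 2) :
    step P ε (a + b) z = step P ε a z + step P ε b z := by
  funext j
  simp only [step, Pi.add_apply, Fin.sum_univ_two]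
  ring

theorem foldl_step_add (a b : Fin 2 → ℝ) (l : List (Fin 2)) :
    l.foldl (step P ε) (a + b) = l.foldl (step P ε) a + l.foldl (step P ε) b := by
  induction l generalizing a b with
  | nil => rfl
  | cons z l ih => simp only [List.foldl_cons, step_add, ih]

/-- This is stationarity: the two noise weights add up to one, so reading an unspecified first
letter applies the bare transition matrix, which fixes `statDist`; linearity of `step` carries this
through the rest of the word. -/
theorem sum_listProb_cons (hrow : ∀ i, P i 0 + P i 1 = 1) (hpos : ∀ i j, 0 < P i j)
    (l : List (Fin 2)) : ∑ z, listProb P ε (z :: l) = listProb P ε l := by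
  have h : weight P ε (0 :: l) + weight P ε (1 :: l) = weight P ε l := by
    simp only [weight, List.foldl_cons, ← foldl_step_add, step_statDist_sum hrow hpos]
  simp only [Fin.sum_univ_two, listProb, ← h, Pi.add_apply]
  ring

theorem sum_snoc {M : Type*} [AddCommMonoid M] {n : ℕ} (g : (Fin (n + 1) → Fin 2) → M) :
    ∑ w, g w = ∑ z, ∑ w : Fin n → Fin 2, g (Fin.snoc w z) := by
  rw [← (Fin.snocEquiv fun _ : Fin (n + 1) => Fin 2).sum_comp, Fintype.sum_prod_type]
  rfl

theorem sum_cons {M : Type*} [AddCommMonoid M] {n : ℕ} (g : (Fin (n + 1) → Fin 2) → M) :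
    ∑ w, g w = ∑ z, ∑ w : Fin n → Fin 2, g (Fin.cons z w) := by
  rw [← (Fin.consEquiv fun _ : Fin (n + 1) => Fin 2).sum_comp, Fintype.sum_prod_type]
  rfl

theorem sum_append {M : Type*} [AddCommMonoid M] {m n : ℕ} (g : (Fin (m + n) → Fin 2) → M) :
    ∑ w, g w = ∑ u : Fin m → Fin 2, ∑ v : Fin n → Fin 2, g (Fin.append u v) := by
  rw [← (Fin.appendEquiv m n).sum_comp, Fintype.sum_prod_type]
  rfl

theorem ofFn_snoc {n : ℕ} (w : Fin n → Fin 2) (z : Fin 2) :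
    List.ofFn (Fin.snoc w z : Fin (n + 1) → Fin 2) = List.ofFn w ++ [z] := by
  rw [List.ofFn_succ']
  simp

theorem sum_listProb_ofFn_append (hrow : ∀ i, P i 0 + P i 1 = 1) (hpos : ∀ i j, 0 < P i j)
    (n : ℕ) (l : List (Fin 2)) :
    ∑ u : Fin n → Fin 2, listProb P ε (List.ofFn u ++ l) = listProb P ε l := by
  induction n with
  | zero => simp
  | succ n ih =>
    rw [sum_cons, Finset.sum_comm, ← ih]
    refine Finset.sum_congr rfl fun u _ => ?_
    simp only [List.ofFn_cons, List.cons_append]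
    exact sum_listProb_cons hrow hpos _

theorem sum_listProb_append_ofFn (hrow : ∀ i, P i 0 + P i 1 = 1)
    (hpos : ∀ i j, 0 < P i j) (hε₀ : 0 < ε) (hε₁ : ε < 1) (n : ℕ) (l : List (Fin 2)) :
    ∑ v : Fin n → Fin 2, listProb P ε (l ++ List.ofFn v) = listProb P ε l := by
  induction n with
  | zero => simp
  | succ n ih =>
    rw [sum_snoc, Finset.sum_comm, ← ih]
    refine Finset.sum_congr rfl fun u _ => ?_
    simp only [ofFn_snoc, ← List.append_assoc]
    exact sum_listProb_append_singleton hrow hpos hε₀ hε₁ _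

theorem sum_listProb (hrow : ∀ i, P i 0 + P i 1 = 1) (hpos : ∀ i j, 0 < P i j) (n : ℕ) :
    ∑ v : Fin n → Fin 2, listProb P ε (List.ofFn v) = 1 := by
  simpa [listProb_nil hpos] using sum_listProb_ofFn_append (ε := ε) hrow hpos n []

/-! ### Block entropy: subadditivity and increments. -/

/-- The block entropy, computed from the forward recursion. -/
noncomputable def listEntropy (P : Matrix (Fin 2) (Fin 2) ℝ) (ε : ℝ) (n : ℕ) : ℝ :=
  -∑ w : Fin n → Fin 2, listProb P ε (List.ofFn w) * Real.log (listProb P ε (List.ofFn w))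

theorem listEntropy_nonneg (hrow : ∀ i, P i 0 + P i 1 = 1) (hpos : ∀ i j, 0 < P i j)
    (hε₀ : 0 < ε) (hε₁ : ε < 1) (n : ℕ) : 0 ≤ listEntropy P ε n := by
  rw [listEntropy, neg_nonneg]
  refine Finset.sum_nonpos fun w _ => ?_
  have hp := fun v : Fin n → Fin 2 => (listProb_pos hpos hε₀ hε₁ (List.ofFn v)).le
  refine mul_nonpos_of_nonneg_of_nonpos (hp w) (Real.log_nonpos (hp w) ?_)
  rw [← sum_listProb (ε := ε) hrow hpos n]
  exact Finset.single_le_sum (fun v _ => hp v) (Finset.mem_univ w)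

/-- Mutual information is nonnegative: `log t ≤ t - 1` is applied to `t = p(u) p(v) / p(uv)` and
averaged. The marginal on `v` is again a word probability by stationarity. -/
theorem listEntropy_subadditive (hrow : ∀ i, P i 0 + P i 1 = 1) (hpos : ∀ i j, 0 < P i j)
    (hε₀ : 0 < ε) (hε₁ : ε < 1) : Subadditive (listEntropy P ε) := by
  intro m n
  set p := listProb P ε with hp
  have hpp : ∀ l, 0 < p l := listProb_pos hpos hε₀ hε₁
  have h₁ : ∑ u : Fin m → Fin 2, p (List.ofFn u) * Real.log (p (List.ofFn u)) =
      ∑ u : Fin m → Fin 2, ∑ v : Fin n → Fin 2,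
        p (List.ofFn u ++ List.ofFn v) * Real.log (p (List.ofFn u)) := by
    refine Finset.sum_congr rfl fun u _ => ?_
    rw [← Finset.sum_mul, sum_listProb_append_ofFn hrow hpos hε₀ hε₁]
  have h₂ : ∑ v : Fin n → Fin 2, p (List.ofFn v) * Real.log (p (List.ofFn v)) =
      ∑ u : Fin m → Fin 2, ∑ v : Fin n → Fin 2,
        p (List.ofFn u ++ List.ofFn v) * Real.log (p (List.ofFn v)) := by
    rw [Finset.sum_comm]
    refine Finset.sum_congr rfl fun v _ => ?_
    rw [← Finset.sum_mul, sum_listProb_ofFn_append hrow hpos]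
  -- Both laws have total mass one, so the `t - 1` terms cancel on average.
  have h₃ : ∑ u : Fin m → Fin 2, ∑ v : Fin n → Fin 2,
      (p (List.ofFn u) * p (List.ofFn v) - p (List.ofFn u ++ List.ofFn v)) = 0 := by
    simp_rw [Finset.sum_sub_distrib, ← Finset.mul_sum]
    simp_rw [hp, sum_listProb_append_ofFn hrow hpos hε₀ hε₁, sum_listProb hrow hpos]
    simp [sum_listProb hrow hpos]
  simp only [listEntropy, ← hp]
  rw [sum_append, h₁, h₂, ← sub_nonpos, ← h₃]
  simp only [← Finset.sum_neg_distrib, ← Finset.sum_add_distrib, ← Finset.sum_sub_distrib,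
    List.ofFn_fin_append]
  refine Finset.sum_le_sum fun u _ => Finset.sum_le_sum fun v _ => ?_
  have hu := hpp (List.ofFn u)
  have hv := hpp (List.ofFn v)
  have huv := hpp (List.ofFn u ++ List.ofFn v)
  generalize p (List.ofFn u) = a at *
  generalize p (List.ofFn v) = b at *
  generalize p (List.ofFn u ++ List.ofFn v) = c at *
  have hlog := Real.log_le_sub_one_of_pos (show 0 < a * b / c by positivity)
  rw [Real.log_div (by positivity) huv.ne', Real.log_mul hu.ne' hv.ne'] at hlog
  have := mul_le_mul_of_nonneg_left hlog huv.le
  have e : c * (a * b / c - 1) = a * b - c := by field_simp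
  linarith

theorem listEntropy_succ_sub (hrow : ∀ i, P i 0 + P i 1 = 1) (hpos : ∀ i j, 0 < P i j)
    (hε₀ : 0 < ε) (hε₁ : ε < 1) (n : ℕ) :
    listEntropy P ε (n + 1) - listEntropy P ε n = ∑ w : Fin n → Fin 2,
      r P ε (filterRatio P ε (P 1 0 / P 0 1) (List.ofFn w)) * listProb P ε (List.ofFn w) := by
  simp only [listEntropy]
  rw [sum_snoc, Finset.sum_comm, neg_sub_neg, ← Finset.sum_sub_distrib]
  refine Finset.sum_congr rfl fun w _ => ?_
  simp only [ofFn_snoc, listProb_append_singleton hpos hε₀ hε₁, Fin.sum_univ_two]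
  have hp := listProb_pos hpos hε₀ hε₁ (List.ofFn w)
  have hx := filterRatio_pos hpos hε₀ hε₁ (List.ofFn w)
  have h0 := rProb_pos hpos hε₀ hε₁ hx 0
  have h1 := rProb_pos hpos hε₀ hε₁ hx 1
  have hs := rProb_add (ε := ε) hrow hx
  rw [Real.log_mul hp.ne' h0.ne', Real.log_mul hp.ne' h1.ne', r]
  linear_combination (-listProb P ε (List.ofFn w) * Real.log (listProb P ε (List.ofFn w))) * hs

/-! ### The interval `I` and the starting point of the filter. -/

theorem fixedPoint_spec (hpos : ∀ i j, 0 < P i j) (hε₀ : 0 < ε) (hε₁ : ε < 1) (z : Fin 2) :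
    0 < fixedPoint P ε z ∧ f P ε z (fixedPoint P ε z) = fixedPoint P ε z :=
  Classical.epsilon_spec (p := fun x : ℝ => 0 < x ∧ f P ε z x = x)
    (existsUnique_pos_fixedPoint P ε hpos hε₀ hε₁ z).exists

theorem interval_pos (hpos : ∀ i j, 0 < P i j) (hε₀ : 0 < ε) (hε₁ : ε < 1) {x : ℝ}
    (hx : x ∈ interval P ε) : 0 < x :=
  (lt_min (fixedPoint_spec hpos hε₀ hε₁ 1).1 (fixedPoint_spec hpos hε₀ hε₁ 0).1).trans_le hx.1

/-- The excess of the fixed point over the stationary ratio has the sign of `c - 1`, where `c`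
is the noise ratio. -/
theorem fixedPoint_excess (hrow : ∀ i, P i 0 + P i 1 = 1) (hpos : ∀ i j, 0 < P i j)
    (hε₀ : 0 < ε) (hε₁ : ε < 1) (z : Fin 2) :
    noiseProb ε (1 - z) * ((P 0 1 * fixedPoint P ε z - P 1 0) * (fixedPoint P ε z + 1)) =
      (noiseProb ε z - noiseProb ε (1 - z)) * (P 0 0 * fixedPoint P ε z + P 1 0) := by
  obtain ⟨hp, hf⟩ := fixedPoint_spec hpos hε₀ hε₁ z
  have hz := noiseProb_pos hε₀ hε₁ (1 - z)
  have h01 := hpos 0 1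
  have h11 := hpos 1 1
  have h0 := hrow 0
  have h1 := hrow 1
  generalize fixedPoint P ε z = p at *
  have hd : P 0 1 * p + P 1 1 ≠ 0 := by positivity
  have e0 : P 0 0 = 1 - P 0 1 := by linarith
  have e1 : P 1 1 = 1 - P 1 0 := by linarith
  rw [f, div_mul_div_comm, div_eq_iff (mul_ne_zero hz.ne' hd), e0, e1] at hf
  rw [e0]
  -- With unit row sums, `π₀₀ p + π₁₀ - p (π₀₁ p + π₁₁) = -(π₀₁ p - π₁₀)(p + 1)`.
  linear_combination -hf

/-- By `fixedPoint_excess`, the side of the stationary ratio on which `p_z` lies is decided by the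
sign of `p_E(z) - p_E(1 - z)`, which flips with `z`; hence the ratio separates `p_0` from `p_1`. -/
theorem statRatio_mem_interval (hrow : ∀ i, P i 0 + P i 1 = 1) (hpos : ∀ i j, 0 < P i j)
    (hε₀ : 0 < ε) (hε₁ : ε < 1) : P 1 0 / P 0 1 ∈ interval P ε := by
  have h00 := hpos 0 0
  have h01 := hpos 0 1
  have h10 := hpos 1 0
  have key : ∀ z : Fin 2,
      (noiseProb ε z ≤ noiseProb ε (1 - z) → fixedPoint P ε z ≤ P 1 0 / P 0 1) ∧
      (noiseProb ε (1 - z) ≤ noiseProb ε z → P 1 0 / P 0 1 ≤ fixedPoint P ε z) := by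
    intro z
    have he := fixedPoint_excess hrow hpos hε₀ hε₁ z
    have hp := (fixedPoint_spec hpos hε₀ hε₁ z).1
    have hz := noiseProb_pos hε₀ hε₁ (1 - z)
    generalize fixedPoint P ε z = p at *
    have hp1 : 0 < p + 1 := by positivity
    have hq : 0 < P 0 0 * p + P 1 0 := by positivity
    constructor <;> intro h
    · rw [le_div_iff₀ h01]
      by_contra! hcon
      have h1 : 0 < P 0 1 * p - P 1 0 := by linarith
      have h2 := mul_pos hz (mul_pos h1 hp1)
      have h3 := mul_nonneg (sub_nonneg.2 h) hq.le
      linarith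
    · rw [div_le_iff₀ h01]
      by_contra! hcon
      have h1 : 0 < P 1 0 - P 0 1 * p := by linarith
      have h2 := mul_pos hz (mul_pos h1 hp1)
      have h3 := mul_nonneg (sub_nonneg.2 h) hq.le
      linarith
  have k0 := key 0
  have k1 := key 1
  simp only [sub_zero, sub_self] at k0 k1
  rw [interval, Set.mem_uIcc]
  rcases le_total (noiseProb ε 0) (noiseProb ε 1) with h | h
  · exact Or.inr ⟨k0.1 h, k1.2 h⟩
  · exact Or.inl ⟨k1.1 h, k0.2 h⟩

/-! ### Compactness, invariance of `I` and bounds on the increments. -/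

theorem f_pos (hpos : ∀ i j, 0 < P i j) (hε₀ : 0 < ε) (hε₁ : ε < 1) (z : Fin 2) {x : ℝ}
    (hx : 0 < x) : 0 < f P ε z x := by
  have h0 := noiseProb_pos hε₀ hε₁ z
  have h1 := noiseProb_pos hε₀ hε₁ (1 - z)
  have h00 := hpos 0 0
  have h01 := hpos 0 1
  have h10 := hpos 1 0
  have h11 := hpos 1 1
  unfold f
  positivity

theorem continuousOn_f (hpos : ∀ i j, 0 < P i j) (z : Fin 2) :
    ContinuousOn (f P ε z) (Set.Ioi 0) := by
  unfold f
  refine continuousOn_const.mul (ContinuousOn.div (by fun_prop) (by fun_prop) ?_)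
  intro x hx
  have hx : 0 < x := hx
  have h01 := hpos 0 1
  have h11 := hpos 1 1
  positivity

theorem continuousOn_filterRatio (hpos : ∀ i j, 0 < P i j) (hε₀ : 0 < ε) (hε₁ : ε < 1)
    (l : List (Fin 2)) :
    ContinuousOn (fun x => filterRatio P ε x l) (Set.Ioi 0) ∧
      Set.MapsTo (fun x => filterRatio P ε x l) (Set.Ioi 0) (Set.Ioi 0) := by
  induction l with
  | nil => exact ⟨continuousOn_id, fun _ h => h⟩
  | cons z l ih =>
    have hm : Set.MapsTo (f P ε z) (Set.Ioi 0) (Set.Ioi 0) :=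
      fun _ hx => f_pos hpos hε₀ hε₁ z hx
    exact ⟨ih.1.comp (continuousOn_f hpos z) hm, ih.2.comp hm⟩

theorem continuousOn_r (hpos : ∀ i j, 0 < P i j) (hε₀ : 0 < ε) (hε₁ : ε < 1) :
    ContinuousOn (r P ε) (Set.Ioi 0) := by
  have h : ∀ z, ContinuousOn (rProb P ε z) (Set.Ioi 0) := by
    intro z
    unfold rProb
    refine ContinuousOn.div (by fun_prop) (by fun_prop) ?_
    intro x hx
    have hx : 0 < x := hx
    positivity
  have hl : ∀ z, ContinuousOn (fun x => Real.log (rProb P ε z x)) (Set.Ioi 0) := fun z =>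
    (h z).log fun x hx => (rProb_pos hpos hε₀ hε₁ hx z).ne'
  exact (((h 0).mul (hl 0)).add ((h 1).mul (hl 1))).neg

theorem isCompact_r_image_cylinder (hpos : ∀ i j, 0 < P i j) (hε₀ : 0 < ε) (hε₁ : ε < 1)
    {n : ℕ} (w : Fin n → Fin 2) : IsCompact (r P ε '' cylinder P ε w) := by
  have hI : interval P ε ⊆ Set.Ioi 0 := fun x hx => interval_pos hpos hε₀ hε₁ hx
  obtain ⟨hc, hm⟩ := continuousOn_filterRatio (P := P) hpos hε₀ hε₁ (List.ofFn w)
  have hcyl : IsCompact (cylinder P ε w) := isCompact_uIcc.image_of_continuousOn (hc.mono hI)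
  refine hcyl.image_of_continuousOn ((continuousOn_r hpos hε₀ hε₁).mono ?_)
  rintro _ ⟨x, hx, rfl⟩
  exact hm (hI hx)

theorem nonempty_r_image_cylinder {n : ℕ} (w : Fin n → Fin 2) :
    (r P ε '' cylinder P ε w).Nonempty :=
  (Set.nonempty_uIcc.image _).image _

theorem filterRatio_mem_interval (hno : NonOverlapping P ε) {x : ℝ} (hx : x ∈ interval P ε)
    (l : List (Fin 2)) : filterRatio P ε x l ∈ interval P ε := by
  induction l generalizing x with
  | nil => exact hx
  | cons z l ih =>
    refine ih (hno.1 ?_)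
    fin_cases z
    · exact Or.inl ⟨x, hx, rfl⟩
    · exact Or.inr ⟨x, hx, rfl⟩

theorem filterRatio_append_mem_cylinder (hno : NonOverlapping P ε) {x : ℝ}
    (hx : x ∈ interval P ε) (l : List (Fin 2)) {n : ℕ} (w : Fin n → Fin 2) :
    filterRatio P ε x (l ++ List.ofFn w) ∈ cylinder P ε w := by
  refine ⟨filterRatio P ε x l, filterRatio_mem_interval hno hx l, ?_⟩
  simp [filterRatio]

theorem listEntropy_increment_bounds (hrow : ∀ i, P i 0 + P i 1 = 1)
    (hpos : ∀ i j, 0 < P i j) (hε₀ : 0 < ε) (hε₁ : ε < 1) (hno : NonOverlapping P ε)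
    (k n : ℕ) :
    ∑ w : Fin n → Fin 2, rMin P ε w * listProb P ε (List.ofFn w) ≤
        listEntropy P ε (k + n + 1) - listEntropy P ε (k + n) ∧
      listEntropy P ε (k + n + 1) - listEntropy P ε (k + n) ≤
        ∑ w : Fin n → Fin 2, rMax P ε w * listProb P ε (List.ofFn w) := by
  -- Stationarity inserts an arbitrary past `u` of length `k` in front of `w`.
  have hsum : ∀ g : (Fin n → Fin 2) → ℝ,
      ∑ w, g w * listProb P ε (List.ofFn w) = ∑ u : Fin k → Fin 2, ∑ w : Fin n → Fin 2,
        g w * listProb P ε (List.ofFn u ++ List.ofFn w) := by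
    intro g
    rw [Finset.sum_comm]
    refine Finset.sum_congr rfl fun w _ => ?_
    rw [← Finset.mul_sum, sum_listProb_ofFn_append hrow hpos]
  have hmem : ∀ (u : Fin k → Fin 2) (w : Fin n → Fin 2),
      r P ε (filterRatio P ε (P 1 0 / P 0 1) (List.ofFn u ++ List.ofFn w)) ∈
        r P ε '' cylinder P ε w := fun u w =>
    Set.mem_image_of_mem _ (filterRatio_append_mem_cylinder hno
      (statRatio_mem_interval hrow hpos hε₀ hε₁) _ w)
  rw [listEntropy_succ_sub hrow hpos hε₀ hε₁, sum_append, hsum, hsum]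
  simp only [List.ofFn_fin_append]
  constructor <;> refine Finset.sum_le_sum fun u _ => Finset.sum_le_sum fun w _ =>
    mul_le_mul_of_nonneg_right ?_ (listProb_pos hpos hε₀ hε₁ _).le
  · exact csInf_le (isCompact_r_image_cylinder hpos hε₀ hε₁ w).bddBelow (hmem u w)
  · exact le_csSup (isCompact_r_image_cylinder hpos hε₀ hε₁ w).bddAbove (hmem u w)

/-- If the increments of `b` are eventually at least `a`, so is the limit of `b n / n`. -/
theorem le_of_tendsto_div_of_le_sub {b : ℕ → ℝ} {a h : ℝ} {n : ℕ}
    (hb : ∀ k, a ≤ b (k + n + 1) - b (k + n))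
    (hlim : Tendsto (fun m : ℕ => b m / m) atTop (𝓝 h)) : a ≤ h := by
  -- Telescoping gives a linear minorant of slope `a`; the initial value `b n` disappears after
  -- division by the length.
  have hk : ∀ k : ℕ, b n + k * a ≤ b (k + n) := by
    intro k
    induction k with
    | zero => simp
    | succ k ih =>
      have := hb k
      rw [show k + 1 + n = k + n + 1 by ring]
      push_cast
      linarith
  have h1 : Tendsto (fun m : ℕ => (b n - n * a) / m + a) atTop (𝓝 (0 + a)) :=
    (tendsto_const_div_atTop_nhds_zero_nat _).add_const a
  rw [zero_add] at h1
  refine le_of_tendsto_of_tendsto h1 hlim ?_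
  filter_upwards [eventually_ge_atTop (n + 1)] with m hm
  have hm0 : (0 : ℝ) < m := by exact_mod_cast (by omega : 0 < m)
  obtain ⟨k, rfl⟩ : ∃ k, m = k + n := ⟨m - n, by omega⟩
  have := hk k
  rw [div_add' _ _ _ hm0.ne', div_le_div_iff_of_pos_right hm0]
  push_cast
  linarith

end Algebra

/-! ### The law of the output process. -/

section Law

variable {Ω : Type*} [MeasurableSpace Ω] {μ : Measure Ω}
  {P : Matrix (Fin 2) (Fin 2) ℝ} {ε : ℝ} {Y E : ℤ → Ω → Fin 2}

theorem IsStationaryMarkovChain.real_path_snoc (hY : IsStationaryMarkovChain μ Y P) (n : ℕ)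
    (y : Fin (n + 1) → Fin 2) (j : Fin 2) :
    μ.real {ω | ∀ k : Fin (n + 2),
        Y ((k : ℕ) : ℤ) ω = (Fin.snoc y j : Fin (n + 2) → Fin 2) k} =
      μ.real {ω | ∀ k : Fin (n + 1), Y ((k : ℕ) : ℤ) ω = y k} * P (y (Fin.last n)) j := by
  -- The path is extended to all of `ℕ` by `j`; only its value at `n + 1` matters.
  have h := hY.markov 0 n fun k => if h : k < n + 1 then y ⟨k, h⟩ else j
  have e₁ : {ω | ∀ k : Fin (n + 2),
      Y ((k : ℕ) : ℤ) ω = (Fin.snoc y j : Fin (n + 2) → Fin 2) k} =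
      {ω | ∀ k : ℕ, k ≤ n + 1 → Y (0 + k) ω = if h : k < n + 1 then y ⟨k, h⟩ else j} := by
    ext ω
    simp only [Set.mem_ofPred_eq, zero_add, Fin.forall_iff, Nat.lt_succ_iff]
    refine forall₂_congr fun k hk => ?_
    simp [Fin.snoc]
  have e₂ : {ω | ∀ k : Fin (n + 1), Y ((k : ℕ) : ℤ) ω = y k} =
      {ω | ∀ k : ℕ, k ≤ n → Y (0 + k) ω = if h : k < n + 1 then y ⟨k, h⟩ else j} := by
    ext ω
    simp only [Set.mem_ofPred_eq, zero_add, Fin.forall_iff, Nat.lt_succ_iff]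
    refine forall₂_congr fun k hk => ?_
    rw [dif_pos hk]
  rw [e₁, e₂, h]
  simp [Fin.last]

/-- The probability of an output word together with a hidden path. -/
noncomputable def pathProb (μ : Measure Ω) (Y : ℤ → Ω → Fin 2) (ε : ℝ) {n : ℕ}
    (y : Fin (n + 1) → Fin 2) (w : Fin n → Fin 2) : ℝ :=
  μ.real {ω | ∀ k : Fin (n + 1), Y ((k : ℕ) : ℤ) ω = y k} *
    ∏ k : Fin n, noiseProb ε (w k + y k.succ)

theorem pathProb_snoc (hY : IsStationaryMarkovChain μ Y P) {n : ℕ} (y : Fin (n + 1) → Fin 2)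
    (w : Fin n → Fin 2) (j z : Fin 2) :
    pathProb μ Y ε (Fin.snoc y j : Fin (n + 2) → Fin 2) (Fin.snoc w z : Fin (n + 1) → Fin 2) =
      noiseProb ε (z + j) * (pathProb μ Y ε y w * P (y (Fin.last n)) j) := by
  rw [pathProb, hY.real_path_snoc, Fin.prod_univ_castSucc, pathProb]
  simp only [Fin.succ_castSucc, Fin.snoc_castSucc, Fin.succ_last, Fin.snoc_last]
  ring

variable [IsProbabilityMeasure μ]

theorem sum_real_inter_fiber {β : Type*} [Fintype β] [MeasurableSpace β]
    [MeasurableSingletonClass β] {X : Ω → β} (hX : Measurable X) (s : Set Ω) :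
    μ.real s = ∑ b, μ.real (s ∩ {ω | X ω = b}) := by
  have h := sum_measureReal_preimage_singleton (μ := μ.restrict s) Finset.univ (f := X)
    fun b _ => hX (measurableSet_singleton b)
  rw [Finset.coe_univ, Set.preimage_univ, measureReal_restrict_apply MeasurableSet.univ,
    Set.univ_inter] at h
  rw [← h]
  refine Finset.sum_congr rfl fun b _ => ?_
  rw [measureReal_restrict_apply (hX (measurableSet_singleton b)), Set.inter_comm]
  rfl

/-- Shift invariance and the one-step Markov property give the balance equation, whose only solution
of total mass one is `statDist`. -/
theorem IsStationaryMarkovChain.real_eq (hrow : ∀ i, P i 0 + P i 1 = 1)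
    (hpos : ∀ i j, 0 < P i j) (hY : IsStationaryMarkovChain μ Y P) (j : Fin 2) :
    μ.real {ω | Y 0 ω = j} = statDist P j := by
  have hstat : ∀ j, μ.real {ω | Y 1 ω = j} = μ.real {ω | Y 0 ω = j} := by
    intro j
    have h := (hY.stationary 1).measure_mem_eq
      (s := {g : ℤ → Fin 2 | g 0 = j}) (measurableSet_eq_fun (measurable_pi_apply 0) measurable_const)
    simp only [Set.preimage_ofPred_eq, zero_add] at h
    rw [measureReal_def, measureReal_def, h]
  have hstep : ∀ j, μ.real {ω | Y 1 ω = j} = ∑ i, μ.real {ω | Y 0 ω = i} * P i j := by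
    intro j
    rw [sum_real_inter_fiber (hY.measurable 0)]
    refine Finset.sum_congr rfl fun i _ => ?_
    have h := hY.real_path_snoc 0 (fun _ => i) j
    rw [show {ω | Y 0 ω = i} = {ω | ∀ k : Fin 1, Y ((k : ℕ) : ℤ) ω = i} by
      ext ω; simp, ← h]
    congr 1
    ext ω
    simp [Fin.forall_fin_two, Fin.snoc, and_comm]
  have htot : ∑ i, μ.real {ω | Y 0 ω = i} = 1 := by
    simpa using (sum_real_inter_fiber (μ := μ) (hY.measurable 0) Set.univ).symm
  have h0 := (hstat 0).symm.trans (hstep 0)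
  simp only [Fin.sum_univ_two] at h0 htot
  have h01 := hpos 0 1
  have h10 := hpos 1 0
  have hr := hrow 0
  generalize ha' : μ.real {ω | Y 0 ω = 0} = a at *
  generalize hb : μ.real {ω | Y 0 ω = 1} = b at *
  have hb' : b = 1 - a := by linarith
  have e0 : P 0 0 = 1 - P 0 1 := by linarith
  have ha : a * (P 0 1 + P 1 0) = P 1 0 := by
    rw [hb', e0] at h0
    linarith
  fin_cases j
  · simp only [Fin.zero_eta, statDist, Matrix.cons_val_zero, ha']
    rwa [eq_div_iff (by positivity)]
  · simp only [Fin.mk_one, statDist, Matrix.cons_val_one, Matrix.cons_val_zero, hb]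
    rw [eq_div_iff (by positivity), hb', sub_mul, ha]
    ring

theorem IsBernoulliNoise.real_eq (hE : IsBernoulliNoise μ E ε) (t : ℤ) (z : Fin 2) :
    μ.real {ω | E t ω = z} = noiseProb ε z := by
  have htot : ∑ i, μ.real {ω | E t ω = i} = 1 := by
    simpa using (sum_real_inter_fiber (μ := μ) (hE.measurable t) Set.univ).symm
  rw [Fin.sum_univ_two, hE.prob_one] at htot
  fin_cases z
  · simp [noiseProb]
    linarith
  · simp [noiseProb, hE.prob_one]

theorem IsBernoulliNoise.real_path (hE : IsBernoulliNoise μ E ε) (n : ℕ) (e : Fin n → Fin 2) :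
    μ.real {ω | ∀ k : Fin n, E ((k : ℕ) + 1) ω = e k} = ∏ k, noiseProb ε (e k) := by
  have hinj : Function.Injective fun k : Fin n => ((k : ℕ) : ℤ) + 1 := by
    intro a b h
    simpa [Fin.ext_iff] using h
  have h := (hE.indep.precomp hinj).measure_inter_preimage_eq_mul Finset.univ
    (sets := fun k => {e k}) fun k _ => measurableSet_singleton _
  rw [show {ω | ∀ k : Fin n, E ((k : ℕ) + 1) ω = e k} =
      ⋂ k ∈ (Finset.univ : Finset (Fin n)), E ((k : ℕ) + 1) ⁻¹' {e k} by ext ω; simp,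
    measureReal_def, h, ENNReal.toReal_prod]
  exact Finset.prod_congr rfl fun k _ => hE.real_eq _ _

theorem real_path_inter_noise
    (hE : IsBernoulliNoise μ E ε)
    (hYE : IndepFun (fun (ω : Ω) (t : ℤ) => Y t ω) (fun (ω : Ω) (t : ℤ) => E t ω) μ)
    (n : ℕ) (y : Fin (n + 1) → Fin 2) (e : Fin n → Fin 2) :
    μ.real ({ω | ∀ k : Fin n, E ((k : ℕ) + 1) ω = e k} ∩
        {ω | ∀ k : Fin (n + 1), Y ((k : ℕ) : ℤ) ω = y k}) =
      μ.real {ω | ∀ k : Fin (n + 1), Y ((k : ℕ) : ℤ) ω = y k} * ∏ k, noiseProb ε (e k) := by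
  have hcoord : ∀ (t : ℤ) (z : Fin 2), MeasurableSet {g : ℤ → Fin 2 | g t = z} :=
    fun t z => measurableSet_eq_fun (measurable_pi_apply t) measurable_const
  have h := hYE.measure_inter_preimage_eq_mul
    {g : ℤ → Fin 2 | ∀ k : Fin (n + 1), g ((k : ℕ) : ℤ) = y k}
    {g : ℤ → Fin 2 | ∀ k : Fin n, g ((k : ℕ) + 1) = e k}
    (by rw [Set.ofPred_forall]; exact MeasurableSet.iInter fun k => hcoord _ _)
    (by rw [Set.ofPred_forall]; exact MeasurableSet.iInter fun k => hcoord _ _)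
  simp only [Set.preimage_ofPred_eq] at h
  rw [← hE.real_path, Set.inter_comm, measureReal_def, h, ENNReal.toReal_mul]
  rfl

/-- Summing out all hidden states but the last turns the path sum into the forward recursion. Paths
start at time 0, one step before the first output, so the empty word carries the law of `Y 0`. -/
theorem sum_pathProb_snoc (hrow : ∀ i, P i 0 + P i 1 = 1) (hpos : ∀ i j, 0 < P i j)
    (hY : IsStationaryMarkovChain μ Y P) {n : ℕ} (w : Fin n → Fin 2) (j : Fin 2) :
    ∑ y : Fin n → Fin 2, pathProb μ Y ε (Fin.snoc y j : Fin (n + 1) → Fin 2) w =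
      weight P ε (List.ofFn w) j := by
  induction n generalizing j with
  | zero =>
    simp [pathProb, weight, ← hY.real_eq hrow hpos, Fin.snoc]
  | succ n ih =>
    obtain ⟨z, w, rfl⟩ : ∃ z, ∃ w' : Fin n → Fin 2, w = Fin.snoc w' z :=
      ⟨w (Fin.last n), Fin.init w, (Fin.snoc_init_self w).symm⟩
    rw [ofFn_snoc, weight_append_singleton, step, sum_snoc, Finset.mul_sum]
    refine Finset.sum_congr rfl fun i _ => ?_
    rw [← ih, Finset.sum_mul, Finset.mul_sum]
    refine Finset.sum_congr rfl fun y _ => ?_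
    rw [pathProb_snoc hY, Fin.snoc_last]

theorem add_eq_iff_eq_add (a b c : Fin 2) : a + b = c ↔ b = c + a := by
  revert a b c
  decide

/-- Once the hidden path is fixed, the output word determines the noise letters, and independence
factors the probability. -/
theorem wordProb_eq_listProb (hrow : ∀ i, P i 0 + P i 1 = 1) (hpos : ∀ i j, 0 < P i j)
    (hY : IsStationaryMarkovChain μ Y P) (hE : IsBernoulliNoise μ E ε)
    (hYE : IndepFun (fun (ω : Ω) (t : ℤ) => Y t ω) (fun (ω : Ω) (t : ℤ) => E t ω) μ)
    {n : ℕ} (w : Fin n → Fin 2) :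
    wordProb μ (output Y E) w = listProb P ε (List.ofFn w) := by
  have hX : Measurable fun (ω : Ω) (k : Fin (n + 1)) => Y ((k : ℕ) : ℤ) ω :=
    measurable_pi_lambda _ fun k => hY.measurable _
  simp only [listProb, ← sum_pathProb_snoc hrow hpos hY]
  rw [wordProb, sum_real_inter_fiber hX, sum_snoc]
  refine Finset.sum_congr rfl fun j _ => Finset.sum_congr rfl fun y' _ => ?_
  generalize (Fin.snoc y' j : Fin (n + 1) → Fin 2) = y
  rw [pathProb, ← real_path_inter_noise hE hYE]
  congr 1
  ext ω
  simp only [Set.mem_inter_iff, Set.mem_ofPred_eq, funext_iff, output]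
  refine and_congr_left fun hy => forall_congr' fun k => ?_
  have hk := hy k.succ
  rw [Fin.val_succ, Nat.cast_succ] at hk
  rw [hk, add_eq_iff_eq_add]

end Law

end NoisyChain

theorem mainTheorem8 {Ω : Type*} [MeasurableSpace Ω] (μ : Measure Ω) [IsProbabilityMeasure μ]
    (P : Matrix (Fin 2) (Fin 2) ℝ) (ε : ℝ) (Y E : ℤ → Ω → Fin 2)
    (hrow : ∀ i, P i 0 + P i 1 = 1) (hpos : ∀ i j, 0 < P i j) (hdet : 0 < P.det)
    (hε₀ : 0 < ε) (hε₁ : ε < 1)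
    (hY : NoisyChain.IsStationaryMarkovChain μ Y P)
    (hE : NoisyChain.IsBernoulliNoise μ E ε)
    (hYE : IndepFun (fun (ω : Ω) (t : ℤ) => Y t ω) (fun (ω : Ω) (t : ℤ) => E t ω) μ)
    (hno : NoisyChain.NonOverlapping P ε) :
    (∀ (n : ℕ) (w : Fin n → Fin 2),
      IsLeast (NoisyChain.r P ε '' NoisyChain.cylinder P ε w) (NoisyChain.rMin P ε w) ∧
      IsGreatest (NoisyChain.r P ε '' NoisyChain.cylinder P ε w) (NoisyChain.rMax P ε w)) ∧
    ∃ H : ℝ, NoisyChain.IsEntropyRate μ (NoisyChain.output Y E) H ∧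
      ∀ n : ℕ,
        ∑ w : Fin n → Fin 2,
            NoisyChain.rMin P ε w * NoisyChain.wordProb μ (NoisyChain.output Y E) w ≤ H ∧
        H ≤ ∑ w : Fin n → Fin 2,
            NoisyChain.rMax P ε w * NoisyChain.wordProb μ (NoisyChain.output Y E) w := by
  have hword : ∀ {n : ℕ} (w : Fin n → Fin 2),
      NoisyChain.wordProb μ (NoisyChain.output Y E) w =
        NoisyChain.listProb P ε (List.ofFn w) := fun w =>
    NoisyChain.wordProb_eq_listProb hrow hpos hY hE hYE w
  have hblock : NoisyChain.blockEntropy μ (NoisyChain.output Y E) =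
      NoisyChain.listEntropy P ε := by
    funext n
    simp only [NoisyChain.blockEntropy, NoisyChain.listEntropy, hword]
  have hsub := NoisyChain.listEntropy_subadditive hrow hpos hε₀ hε₁
  -- Fekete's lemma, with the lower bound 0 from nonnegativity of entropy.
  have hlim := hsub.tendsto_lim ⟨0, by
    rintro _ ⟨n, rfl⟩
    exact div_nonneg (NoisyChain.listEntropy_nonneg hrow hpos hε₀ hε₁ n) n.cast_nonneg⟩
  refine ⟨fun n w => ?_, hsub.lim, ?_, fun n => ?_⟩
  · have hc := NoisyChain.isCompact_r_image_cylinder hpos hε₀ hε₁ w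
    have hn := NoisyChain.nonempty_r_image_cylinder (P := P) (ε := ε) w
    exact ⟨hc.isLeast_sInf hn, hc.isGreatest_sSup hn⟩
  · rw [NoisyChain.IsEntropyRate, hblock]
    exact hlim
  · have hb := fun k => NoisyChain.listEntropy_increment_bounds hrow hpos hε₀ hε₁ hno k n
    simp only [hword]
    -- The upper bound is the lower bound for the negated entropies.
    refine ⟨NoisyChain.le_of_tendsto_div_of_le_sub (fun k => (hb k).1) hlim, neg_le_neg_iff.1 ?_⟩
    refine NoisyChain.le_of_tendsto_div_of_le_sub (b := fun m => -NoisyChain.listEntropy P ε m)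
      (n := n) (fun k => ?_) ?_
    · linarith [(hb k).2]
    · simpa only [neg_div] using hlim.neg
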